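/- Write $|X|$ for the Lebesgue measure of a measurable set $X\subseteq\mathbb{R}^d$ and $\widehat{\chi_X}(\xi)=\int_X e^{-2\pi i\,\xi\cdot x}\,dx$ for the Fourier transform of its indicator function. A measurable set $X\subseteq\mathbb{R}^d$ of finite measure is called spectral if there is a set $\Lambda\subseteq\mathbb{R}^d$ (a spectrum of $X$) such that the exponentials $e^{2\pi i\,\lambda\cdot x}$, $\lambda\in\Lambda$, form a complete orthogonal set in $L^2(X)$, that is, they are pairwise orthogonal for distinct $\lambda$ under $\langle f,g\rangle=\int_X f\,\overline{g}$ and their linear span is dense in $L^2(X)$. Let $A\subseteq\mathbb{R}^m$ and $B\subseteq\mathbb{R}^n$ be Lebesgue measurable sets with $|A|=|B|=1$, let $\Omega=A\times B\subseteq\mathbb{R}^m\times\mathbb{R}^n$, and let $D\subseteq\mathbb{R}^m$ be a bounded Lebesgue measurable set such that $$(D-D)\cap\{\xi\in\mathbb{R}^m:\ \widehat{\chi_A}(\xi)=0\}=\emptyset,$$ where $D-D=\{d-d':\ d,d'\in D\}$. (a) If $|D|=1$ and $\Omega$ is spectral, then $B$ is spectral. (b) If $|D|>1$, then $A$ is not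 spectral and $\Omega$ is not spectral. -/

import Mathlib

open MeasureTheory
open scoped Pointwise FourierTransform

section SpectralSets

variable {E : Type*} [NormedAddCommGroup E] [InnerProductSpace ℝ E] [FiniteDimensional ℝ E]
  [MeasurableSpace E] [BorelSpace E]

/-- The exponential `e_ξ(x) = exp (2 π i ξ ⬝ x)`. -/
noncomputable def expFun (ξ : E) : E → ℂ :=
  fun x => Complex.exp (2 * Real.pi * Complex.I * (inner ℝ ξ x : ℝ))

/-- The exponentials `e_ξ`, `ξ ∈ S`, as a set of elements of the Hilbert space `L²(Ω)`. -/
def expSet (Ω S : Set E) : Set (Lp ℂ 2 (volume.restrict Ω)) :=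
  {g | ∃ ξ ∈ S, (g : E → ℂ) =ᵐ[volume.restrict Ω] expFun ξ}

/-- `S` is a spectrum of `Ω`: the exponentials with frequencies in `S` lie in `L²(Ω)` (automatic
if `Ω` has finite measure), are pairwise orthogonal for `⟨f, g⟩ = ∫_Ω f * conj g`, and are complete,
i.e. their linear span is dense in `L²(Ω)`. -/
structure IsSpectrum (Ω S : Set E) : Prop where
  memLp : ∀ ξ ∈ S, MemLp (expFun ξ) 2 (volume.restrict Ω)
  orthogonal : ∀ ξ ∈ S, ∀ η ∈ S, ξ ≠ η →
    ∫ x in Ω, expFun ξ x * (starRingEnd ℂ) (expFun η x) = 0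
  complete : Dense (Submodule.span ℂ (expSet Ω S) : Set (Lp ℂ 2 (volume.restrict Ω)))

/-- `Ω` is a spectral set: it has a spectrum. -/
def IsSpectral (Ω : Set E) : Prop :=
  ∃ S : Set E, IsSpectrum Ω S

/-- The zero set of the Fourier transform `ξ ↦ ∫_A exp (-2 π i ξ ⬝ x) dx` of the indicator
function of `A`. -/
def fourierZeroSet (A : Set E) : Set E :=
  {ξ | 𝓕 (A.indicator (fun _ => (1 : ℂ))) ξ = 0}

end SpectralSets

/-- The Cartesian product `A × B` inside `ℝ^m × ℝ^n` with its Euclidean structure. -/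
def euclideanProd {m n : ℕ} (A : Set (EuclideanSpace ℝ (Fin m)))
    (B : Set (EuclideanSpace ℝ (Fin n))) :
    Set (WithLp 2 (EuclideanSpace ℝ (Fin m) × EuclideanSpace ℝ (Fin n))) :=
  {z | z.fst ∈ A ∧ z.snd ∈ B}

/-!
Let `Λ` be a spectrum of a set `X` of measure `1`. Parseval's identity applied to the exponentials
themselves says that the translates along `Λ` of `g = |𝓕 χ_X|²` add up to `1` everywhere
(`IsSpectrum.tsum_enorm_fourierIndicator_sq`), and Plancherel's identity gives `∫ g = 1`. Now let
`f ≥ 0` *pack* along the same set: `F(x) = ∑ f(λ - x) ≤ 1` for all `x`. Exchanging sum and integral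
shows `∫ F(x) g(x - y) dx = ∫ f` for every `y` (`lintegral_tsum_mul_of_tiling`). Since `F ≤ 1` and
`∫ g = 1`, it follows that `∫ f ≤ 1` (`lintegral_le_of_packing_of_tiling`), and if `∫ f = 1` then
`F = 1` almost everywhere (`ae_tiling_of_packing_of_tiling`).

The hypothesis on `D - D` supplies the packings. For a spectrum of `A` the function `χ_D` packs,
because each translate of `D` contains at most one frequency. For a spectrum `Λ` of `A × B` the
function `χ_D(a) |𝓕 χ_B(b)|²` packs: if `(a, b)`, `(a', b')` are distinct points of `Λ` with `a`,
`a'` in the same translate of `D`, then `𝓕 χ_A(a - a') 𝓕 χ_B(b - b') = 0` has a nonzero first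
factor, so the frequencies `b` belonging to one translate of `D` are orthogonal on `B`, and Bessel's
inequality applies. Both packing functions have integral `|D|`, so spectrality forces `|D| ≤ 1`.

If `|D| = 1`, the second packing is a tiling almost everywhere. By Fubini there is one translate
`D + x` such that the frequencies `b` belonging to it satisfy Parseval's identity for almost every
exponential `e_η` on `B`. Hence almost every `e_η` is in the closed span of these exponentials, and a
function orthogonal to almost every `e_η` has vanishing Fourier transform, so it vanishes
(`isSpectrum_of_ae_tsum_eq_one`).
-/

open scoped ContDiff

/-! ### Orthonormal families in Hilbert spaces -/

section Hilbert
variable {H : Type*} [NormedAddCommGroup H] [InnerProductSpace ℂ H] {ι : Type*} {v : ι → H}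

/-- Bessel's inequality, as a sum in `ℝ≥0∞`. -/
theorem Orthonormal.tsum_enorm_inner_sq_le (hv : Orthonormal ℂ v) (x : H) :
    ∑' i, ‖inner ℂ (v i) x‖ₑ ^ 2 ≤ ‖x‖ₑ ^ 2 := by
  rw [ENNReal.tsum_eq_iSup_sum]
  refine iSup_le fun s => ?_
  have h := hv.sum_inner_products_le x (s := s)
  have h' := ENNReal.ofReal_le_ofReal h
  rw [ENNReal.ofReal_sum_of_nonneg (fun _ _ => by positivity)] at h'
  simpa only [ENNReal.ofReal_pow (norm_nonneg _), ofReal_norm] using h'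

/-- A vector for which Bessel's inequality is an equality lies in the closed span of the family: its
projection to the closed span has the same coefficients, hence the same norm. -/
theorem Orthonormal.mem_topologicalClosure_span_of_le [CompleteSpace H] (hv : Orthonormal ℂ v)
    (x : H) (hx : ‖x‖ₑ ^ 2 ≤ ∑' i, ‖inner ℂ (v i) x‖ₑ ^ 2) :
    x ∈ (Submodule.span ℂ (Set.range v)).topologicalClosure := by
  set K := (Submodule.span ℂ (Set.range v)).topologicalClosure with hK
  have : CompleteSpace K :=
    (Submodule.isClosed_topologicalClosure _).completeSpace_coe
  have hvK : ∀ i, v i ∈ K := fun i =>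
    Submodule.le_topologicalClosure _ (Submodule.subset_span ⟨i, rfl⟩)
  have hin : ∀ i, inner ℂ (v i) x = inner ℂ (v i) (K.starProjection x) := fun i => by
    have := K.starProjection_inner_eq_zero x (v i) (hvK i)
    rw [inner_sub_left, sub_eq_zero] at this
    rw [← inner_conj_symm, this, inner_conj_symm]
  simp_rw [hin] at hx
  have h1 := hx.trans (hv.tsum_enorm_inner_sq_le _)
  have h2 : ‖x‖ ≤ ‖K.starProjection x‖ := by
    rw [ENNReal.pow_le_pow_left_iff two_ne_zero] at h1
    simpa [enorm_le_iff_norm_le] using h1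
  exact (Submodule.mem_iff_norm_starProjection K x).mpr 
    (le_antisymm (K.norm_starProjection_apply_le x) h2)

/-- Parseval's identity, as a sum in `ℝ≥0∞`. -/
theorem HilbertBasis.tsum_enorm_inner_sq (b : HilbertBasis ι ℂ H) (x : H) :
    ∑' i, ‖inner ℂ (b i) x‖ₑ ^ 2 = ‖x‖ₑ ^ 2 := by
  refine le_antisymm (b.orthonormal.tsum_enorm_inner_sq_le x) ?_
  have h := (b.hasSum_inner_mul_inner x x)
  have h1 : HasSum (fun i => ‖inner ℂ (b i) x‖ ^ 2) (‖x‖ ^ 2) := by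
    have := h.mapL Complex.reCLM
    simp only [Complex.reCLM_apply] at this
    convert! this using 1
    · ext i
      rw [← inner_conj_symm x (b i), RCLike.conj_mul]
      norm_cast
    · rw [inner_self_eq_norm_sq_to_K]; norm_cast
  have h2 := ENNReal.ofReal_tsum_of_nonneg (fun _ => by positivity) h1.summable
  rw [h1.tsum_eq] at h2
  simp_rw [ENNReal.ofReal_pow (norm_nonneg _), ofReal_norm] at h2
  exact h2.le

theorem Orthonormal.countable_index [SecondCountableTopology H] (hv : Orthonormal ℂ v) :
    Countable ι := by
  have hd : Pairwise (Function.onFun Disjoint fun i => Metric.ball (v i) (1 / 2)) := by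
    intro i j hij
    refine Metric.ball_disjoint_ball ?_
    have h := norm_sub_sq (𝕜 := ℂ) (v i) (v j)
    rw [hv.inner_eq_zero hij, hv.norm_eq_one, hv.norm_eq_one, map_zero] at h
    rw [dist_eq_norm]
    nlinarith [norm_nonneg (v i - v j)]
  exact hd.countable_of_isOpen_disjoint (fun i => Metric.isOpen_ball)
    fun i => Metric.nonempty_ball.mpr (by norm_num)
end Hilbert

/-! ### Plancherel's identity -/

section Fourier
variable {E : Type*} [NormedAddCommGroup E] [InnerProductSpace ℝ E] [FiniteDimensional ℝ E]
  [MeasurableSpace E] [BorelSpace E]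

/-- For `f ∈ L¹ ∩ L²` the Fourier integral agrees with the Fourier transform on `L²`, since both
represent the Fourier transform of `f` as a tempered distribution. -/
theorem fourier_ae_eq_fourier_toLp {f : E → ℂ} (h1 : Integrable f) (h2 : MemLp f 2) :
    𝓕 f =ᵐ[volume] (𝓕 (h2.toLp f) : Lp ℂ 2 (volume : Measure E)) := by
  have hcont : Continuous (𝓕 f) :=
    VectorFourier.fourierIntegral_continuous Real.continuous_fourierChar
      (by exact continuous_inner) h1
  refine ae_eq_of_integral_contDiff_smul_eq hcont.locallyIntegrable
    ((Lp.memLp _).locallyIntegrable one_le_two) fun g hg hgc => ?_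
  have hc : HasCompactSupport (Complex.ofRealCLM ∘ g) := hgc.comp_left rfl
  have hd : ContDiff ℝ ∞ (Complex.ofRealCLM ∘ g) := by fun_prop
  set φ : SchwartzMap E ℂ := hc.toSchwartzMap hd with hφ
  have key := congrArg (fun T => T φ) (Lp.fourier_toTemperedDistribution_eq (h2.toLp f))
  simp only [TemperedDistribution.fourier_apply, Lp.toTemperedDistribution_apply] at key
  have e1 : ∫ x, (𝓕 φ) x • (h2.toLp f) x = ∫ x, (𝓕 φ) x • f x :=
    integral_congr_ae (by filter_upwards [h2.coeFn_toLp] with x hx; rw [hx])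
  have e2 : ∫ x, φ x • 𝓕 f x = ∫ x, (𝓕 φ) x • f x := by
    have := VectorFourier.integral_fourierIntegral_smul_eq_flip (L := innerₗ E)
      (μ := volume) (ν := volume)
      Real.continuous_fourierChar continuous_inner φ.integrable h1
    rw [flip_innerₗ] at this
    exact this.symm
  calc ∫ x, g x • 𝓕 f x = ∫ x, φ x • 𝓕 f x := by simp [hφ]
    _ = ∫ x, φ x • (𝓕 (h2.toLp f) : Lp ℂ 2 (volume : Measure E)) x := by rw [e2, ← e1, key]
    _ = _ := by simp [hφ]

/-- Plancherel's identity for integrable and square-integrable functions. -/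
theorem lintegral_enorm_fourier_sq {f : E → ℂ} (h1 : Integrable f) (h2 : MemLp f 2) :
    ∫⁻ ξ, ‖𝓕 f ξ‖ₑ ^ 2 = ∫⁻ x, ‖f x‖ₑ ^ 2 := by
  have key : eLpNorm (𝓕 f) 2 volume = eLpNorm f 2 volume := by
    rw [eLpNorm_congr_ae (fourier_ae_eq_fourier_toLp h1 h2), ← Lp.enorm_def,
      ← eLpNorm_congr_ae h2.coeFn_toLp, ← Lp.enorm_def, enorm_eq_iff_norm_eq, Lp.norm_fourier_eq]
  have h : ∀ u : E → ℂ, ∫⁻ x, ‖u x‖ₑ ^ 2 = eLpNorm u 2 volume ^ 2 := fun u => by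
    have := eLpNorm_nnreal_pow_eq_lintegral (f := u) (μ := (volume : Measure E)) (p := 2) two_ne_zero
    simpa using this.symm
  rw [h, h, key]
end Fourier

/-! ### Exponentials and spectra -/

section Exponentials
variable {E : Type*} [NormedAddCommGroup E] [InnerProductSpace ℝ E]

theorem continuous_expFun (ξ : E) : Continuous (expFun ξ) := by
  unfold expFun; fun_prop

theorem norm_expFun (ξ x : E) : ‖expFun ξ x‖ = 1 := by
  rw [expFun, ← Complex.norm_exp_ofReal_mul_I (2 * Real.pi * inner ℝ ξ x)]
  congr 2; push_cast; ring

theorem expFun_mul_conj (ξ η x : E) :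
    expFun ξ x * (starRingEnd ℂ) (expFun η x) = expFun (ξ - η) x := by
  simp only [expFun, ← Complex.exp_conj, ← Complex.exp_add, inner_sub_left]
  congr 1
  simp only [map_mul, Complex.conj_I, Complex.conj_ofReal, map_ofNat]
  push_cast
  ring

end Exponentials

section Spectra
variable {E : Type*} [NormedAddCommGroup E] [InnerProductSpace ℝ E] [FiniteDimensional ℝ E]
  [MeasurableSpace E] [BorelSpace E]

/-- The Fourier transform of the indicator function of `X`. -/
noncomputable def fourierIndicator (X : Set E) : E → ℂ :=
  𝓕 (X.indicator fun _ => (1 : ℂ))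

theorem fourier_eq_integral_expFun_smul (f : E → ℂ) (ξ : E) :
    𝓕 f ξ = ∫ x, expFun (-ξ) x * f x := by
  rw [Real.fourier_eq]
  refine integral_congr_ae (.of_forall fun x => ?_)
  simp only [Circle.smul_def, Real.fourierChar_apply, expFun, smul_eq_mul]
  rw [inner_neg_left, real_inner_comm]
  congr 2; push_cast; ring

theorem fourierIndicator_eq_setIntegral {X : Set E} (hX : MeasurableSet X) (ξ : E) :
    fourierIndicator X ξ = ∫ x in X, expFun (-ξ) x := by
  rw [fourierIndicator, fourier_eq_integral_expFun_smul, ← integral_indicator hX]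
  congr 1; ext x
  by_cases hx : x ∈ X <;> simp [hx]

theorem setIntegral_expFun_mul_conj {X : Set E} (hX : MeasurableSet X) (ξ η : E) :
    ∫ x in X, expFun ξ x * (starRingEnd ℂ) (expFun η x) = fourierIndicator X (η - ξ) := by
  simp_rw [expFun_mul_conj, fourierIndicator_eq_setIntegral hX, neg_sub]

theorem memLp_expFun {X : Set E} (hX : volume X ≠ ⊤) (ξ : E) :
    MemLp (expFun ξ) 2 (volume.restrict X) := by
  have : IsFiniteMeasure (volume.restrict X) := ⟨by simpa using hX.lt_top⟩
  exact MemLp.of_bound (continuous_expFun ξ).aestronglyMeasurable 1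
    (.of_forall fun x => (norm_expFun ξ x).le)

/-- The exponential `e_ξ` as an element of `L²(X)`, for a set `X` of finite measure. -/
noncomputable def expLp {X : Set E} (hX : volume X ≠ ⊤) (ξ : E) :
    Lp ℂ 2 (volume.restrict X) :=
  (memLp_expFun hX ξ).toLp

theorem inner_expLp {X : Set E} (hX : MeasurableSet X) (hX' : volume X ≠ ⊤) (ξ η : E) :
    inner ℂ (expLp hX' ξ) (expLp hX' η) = fourierIndicator X (ξ - η) := by
  rw [L2.inner_def, ← setIntegral_expFun_mul_conj hX]
  refine integral_congr_ae ?_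
  filter_upwards [(memLp_expFun hX' ξ).coeFn_toLp, (memLp_expFun hX' η).coeFn_toLp] with x h1 h2
  rw [expLp, expLp, h1, h2]; rfl

theorem expSet_eq_image {X : Set E} (hX : volume X ≠ ⊤) (S : Set E) :
    expSet X S = expLp hX '' S := by
  ext g
  refine exists_congr fun ξ => and_congr_right fun _ => ?_
  rw [eq_comm, Lp.ext_iff]
  exact ⟨fun h => h.trans (memLp_expFun hX ξ).coeFn_toLp.symm,
    fun h => h.trans (memLp_expFun hX ξ).coeFn_toLp⟩

theorem fourierIndicator_zero {X : Set E} (hX : MeasurableSet X) :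
    fourierIndicator X 0 = (volume X).toReal := by
  simp [fourierIndicator_eq_setIntegral hX, expFun, Measure.real]

theorem enorm_expLp {X : Set E} (hX : MeasurableSet X) (hX' : volume X ≠ ⊤)
    (hX1 : volume X = 1) (ξ : E) : ‖expLp hX' ξ‖ₑ = 1 := by
  have h := inner_expLp hX hX' ξ ξ
  rw [sub_self, fourierIndicator_zero hX, hX1] at h
  have h2 : ‖expLp hX' ξ‖ ^ 2 = 1 := by
    rw [← inner_self_eq_norm_sq (𝕜 := ℂ), h]; simp
  have h3 : ‖expLp hX' ξ‖ = 1 := by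
    rwa [pow_eq_one_iff_of_nonneg (norm_nonneg _) two_ne_zero] at h2
  rw [← ofReal_norm, h3, ENNReal.ofReal_one]

theorem orthonormal_expLp {X : Set E} (hX : MeasurableSet X) (hX' : volume X ≠ ⊤)
    (hX1 : volume X = 1) {ι : Type*} {s : ι → E}
    (hs : Pairwise fun i j => fourierIndicator X (s i - s j) = 0) :
    Orthonormal ℂ fun i => expLp hX' (s i) := by
  refine ⟨fun i => ?_, fun i j hij => ?_⟩
  · rw [← toReal_enorm, enorm_expLp hX hX' hX1]; rfl
  · exact (inner_expLp hX hX' _ _).trans (hs hij)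

theorem continuous_fourierIndicator {X : Set E} (hX : MeasurableSet X) (hX' : volume X ≠ ⊤) :
    Continuous (fourierIndicator X) :=
  VectorFourier.fourierIntegral_continuous Real.continuous_fourierChar
    (by exact continuous_inner) ((integrable_indicator_iff hX).2 (integrableOn_const hX'))

theorem lintegral_enorm_fourierIndicator_sq {X : Set E} (hX : MeasurableSet X)
    (hX' : volume X ≠ ⊤) : ∫⁻ ξ, ‖fourierIndicator X ξ‖ₑ ^ 2 = volume X := by
  rw [fourierIndicator, lintegral_enorm_fourier_sq
    ((integrable_indicator_iff hX).2 (integrableOn_const hX'))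
    (memLp_indicator_const 2 hX 1 (.inr hX')), ← lintegral_indicator_one hX]
  congr 1; ext x
  by_cases hx : x ∈ X <;> simp [hx]

/-- Bessel's inequality for exponentials. -/
theorem tsum_enorm_fourierIndicator_sq_le {X : Set E} (hX : MeasurableSet X)
    (hX1 : volume X = 1) {ι : Type*} {s : ι → E}
    (hs : Pairwise fun i j => fourierIndicator X (s i - s j) = 0) (ξ : E) :
    ∑' i, ‖fourierIndicator X (s i - ξ)‖ₑ ^ 2 ≤ 1 := by
  have hX' : volume X ≠ ⊤ := by simp [hX1]
  have h := (orthonormal_expLp hX hX' hX1 hs).tsum_enorm_inner_sq_le (expLp hX' ξ)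
  simpa [inner_expLp hX, enorm_expLp hX hX' hX1] using h

theorem IsSpectrum.pairwise_fourierIndicator_eq_zero {X S : Set E} (hX : MeasurableSet X)
    (h : IsSpectrum X S) : Pairwise fun i j : S => fourierIndicator X (i - j : E) = 0 := by
  intro i j hij
  rw [← setIntegral_expFun_mul_conj hX]
  exact h.orthogonal _ j.2 _ i.2 fun h => hij (Subtype.ext h.symm)

theorem IsSpectrum.countable {X S : Set E} (hX : MeasurableSet X)
    (hX1 : volume X = 1) (h : IsSpectrum X S) : Countable S :=
  have : Fact ((2 : ENNReal) ≠ ⊤) := ⟨ENNReal.ofNat_ne_top⟩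
  (orthonormal_expLp hX (by simp [hX1]) hX1
    (h.pairwise_fourierIndicator_eq_zero hX)).countable_index

/-- Parseval's identity: `|𝓕 χ_X|²` translated along a spectrum of `X` tiles the frequency space. -/
theorem IsSpectrum.tsum_enorm_fourierIndicator_sq {X S : Set E} (hX : MeasurableSet X)
    (hX1 : volume X = 1) (h : IsSpectrum X S) (ξ : E) :
    ∑' i : S, ‖fourierIndicator X (i - ξ)‖ₑ ^ 2 = 1 := by
  have hX' : volume X ≠ ⊤ := by simp [hX1]
  have ho := orthonormal_expLp hX hX' hX1 (h.pairwise_fourierIndicator_eq_zero hX)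
  have hd : ⊤ ≤ (Submodule.span ℂ (Set.range fun i : S => expLp hX' (i : E))).topologicalClosure := by
    have := h.complete
    rw [expSet_eq_image hX', Set.image_eq_range, Submodule.dense_iff_topologicalClosure_eq_top] at this
    exact this.ge
  have h := (HilbertBasis.mk ho hd).tsum_enorm_inner_sq (expLp hX' ξ)
  simpa [inner_expLp hX, enorm_expLp hX hX' hX1] using h

/-- An element of `L²(X)` that is orthogonal to almost every exponential vanishes. -/
theorem eq_zero_of_ae_inner_expLp_eq_zero {X : Set E} (hX : MeasurableSet X)
    (hX' : volume X ≠ ⊤) (f : Lp ℂ 2 (volume.restrict X))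
    (hf : ∀ᵐ ξ : E, inner ℂ (expLp hX' ξ) f = 0) : f = 0 := by
  have : IsFiniteMeasure (volume.restrict X) := ⟨by simpa using hX'.lt_top⟩
  have h2 : MemLp (X.indicator f) 2 volume := (memLp_indicator_iff_restrict hX).2 (Lp.memLp f)
  have h1 : Integrable (X.indicator f) volume :=
    (integrable_indicator_iff hX).2 ((Lp.memLp f).integrable one_le_two)
  have h0 : ∀ᵐ ξ : E, 𝓕 (X.indicator f) ξ = 0 := by
    filter_upwards [hf] with ξ hξ
    rw [← hξ, L2.inner_def, fourier_eq_integral_expFun_smul, ← integral_indicator hX]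
    have : ∀ᵐ x, x ∈ X → expLp hX' ξ x = expFun ξ x :=
      (ae_restrict_iff' hX).1 (memLp_expFun hX' ξ).coeFn_toLp
    refine integral_congr_ae ?_
    filter_upwards [this] with x hx
    by_cases hxX : x ∈ X
    · have e := expFun_mul_conj 0 ξ x
      have e0 : expFun (0 : E) x = 1 := by simp [expFun]
      rw [zero_sub, e0, one_mul] at e
      simp [hxX, hx hxX, ← e, mul_comm]
    · simp [hxX]
  have h3 := lintegral_enorm_fourier_sq h1 h2
  rw [lintegral_congr_ae (g := 0) (by filter_upwards [h0] with ξ hξ; simp [hξ])] at h3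
  have h4 := (lintegral_eq_zero_iff' (h1.aestronglyMeasurable.enorm.pow_const 2)).1
    (by simpa using h3.symm)
  refine Lp.ext ?_
  rw [Filter.EventuallyEq, ae_restrict_iff' hX]
  filter_upwards [h4, ((ae_restrict_iff' hX).1 (Lp.coeFn_zero ℂ 2 (volume.restrict X)))]
    with x hx hx0 hxX
  rw [hx0 hxX]
  simpa [hxX] using hx

/-- Orthogonal exponentials are complete as soon as they satisfy Parseval's identity on almost every
exponential. -/
theorem isSpectrum_of_ae_tsum_eq_one {X S : Set E} (hX : MeasurableSet X) (hX1 : volume X = 1)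
    (hS : Pairwise fun i j : S => fourierIndicator X (i - j : E) = 0)
    (h : ∀ᵐ ξ : E, ∑' i : S, ‖fourierIndicator X (i - ξ)‖ₑ ^ 2 = 1) : IsSpectrum X S := by
  have hX' : volume X ≠ ⊤ := by simp [hX1]
  refine ⟨fun ξ _ => memLp_expFun hX' ξ, fun ξ hξ η hη hne => ?_, ?_⟩
  · rw [setIntegral_expFun_mul_conj hX]
    exact hS (i := ⟨η, hη⟩) (j := ⟨ξ, hξ⟩) fun h => hne (congrArg Subtype.val h).symm
  rw [expSet_eq_image hX', Set.image_eq_range, Submodule.dense_iff_topologicalClosure_eq_top,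
    Submodule.topologicalClosure_eq_top_iff, Submodule.eq_bot_iff]
  intro f hf
  rw [← Submodule.orthogonal_closure] at hf
  refine eq_zero_of_ae_inner_expLp_eq_zero hX hX' f ?_
  filter_upwards [h] with ξ hξ
  refine hf _ ((orthonormal_expLp hX hX' hX1 hS).mem_topologicalClosure_span_of_le _ ?_)
  simp [inner_expLp hX, enorm_expLp hX hX' hX1, hξ]

/-- Spectrality depends on the set only up to null sets. -/
theorem isSpectral_congr {X Y : Set E} (h : X =ᵐ[volume] Y) (hX : IsSpectral X) :
    IsSpectral Y := by
  -- The type `Lp ℂ 2 (volume.restrict X)` depends on `X`, so the restricted measure is made a variable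
  -- before it is replaced.
  have key : ∀ μ ν : Measure E, μ = ν → ∀ S : Set E,
      Dense (Submodule.span ℂ {g : Lp ℂ 2 μ | ∃ ξ ∈ S, (g : E → ℂ) =ᵐ[μ] expFun ξ} : Set (Lp ℂ 2 μ)) →
      Dense (Submodule.span ℂ {g : Lp ℂ 2 ν | ∃ ξ ∈ S, (g : E → ℂ) =ᵐ[ν] expFun ξ} : Set (Lp ℂ 2 ν)) := by
    rintro μ _ rfl S hS; exact hS
  obtain ⟨S, h1, h2, h3⟩ := hX
  have e := Measure.restrict_congr_set h
  exact ⟨S, by rwa [← e], by rwa [← e], key _ _ e S h3⟩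

theorem fourierZeroSet_congr {X Y : Set E} (h : X =ᵐ[volume] Y) :
    fourierZeroSet X = fourierZeroSet Y := by
  ext ξ
  simp only [fourierZeroSet, Set.mem_ofPred_eq, fourier_eq_integral_expFun_smul]
  rw [integral_congr_ae]
  filter_upwards [indicator_ae_eq_of_ae_eq_set (f := fun _ : E => (1 : ℂ)) h] with x hx
  rw [hx]

end Spectra

/-! ### Packing and tiling -/

section Packing
variable {E : Type*} [NormedAddCommGroup E] [InnerProductSpace ℝ E] [FiniteDimensional ℝ E]
  [MeasurableSpace E] [BorelSpace E]

/-- If the translates of `g` along `S` tile, then the periodization of `f` along `S` has the integral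
`∫ f` against every translate of `g`. -/
theorem lintegral_tsum_mul_of_tiling {S : Set E} [Countable S] {f g : E → ENNReal}
    (hf : Measurable f) (hg : Measurable g) (htile : ∀ ξ, ∑' i : S, g (i - ξ) = 1) (y : E) :
    ∫⁻ x, (∑' i : S, f (i - x)) * g (x - y) = ∫⁻ x, f x := by
  have h1 : ∀ i : S, ∫⁻ x, f (i - x) * g (x - y) = ∫⁻ u, f u * g (i - (y + u)) := fun i => by
    rw [← lintegral_sub_left_eq_self (fun u => f u * g (i - (y + u))) (i : E)]
    refine lintegral_congr fun x => ?_
    congr 2; abel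
  simp_rw [← ENNReal.tsum_mul_right]
  rw [lintegral_tsum fun i => by fun_prop]
  simp_rw [h1]
  rw [← lintegral_tsum fun i => by fun_prop]
  simp_rw [ENNReal.tsum_mul_left, htile, mul_one]

theorem lintegral_le_of_packing_of_tiling {S : Set E} [Countable S] {f g : E → ENNReal}
    (hf : Measurable f) (hg : Measurable g) (hg1 : ∫⁻ x, g x = 1)
    (htile : ∀ ξ, ∑' i : S, g (i - ξ) = 1) (hpack : ∀ ξ, ∑' i : S, f (i - ξ) ≤ 1) :
    ∫⁻ x, f x ≤ 1 := by
  rw [← lintegral_tsum_mul_of_tiling hf hg htile 0, ← hg1]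
  refine lintegral_mono fun x => ?_
  simpa using mul_le_mul_left (hpack x) (g x)

/-- A packing with the same total mass as a tiling along the same set is itself a tiling, up to a null
set. -/
theorem ae_tiling_of_packing_of_tiling {S : Set E} [Countable S] {f g : E → ENNReal}
    (hf : Measurable f) (hg : Measurable g) (hf1 : ∫⁻ x, f x = 1) (hg1 : ∫⁻ x, g x = 1)
    (htile : ∀ ξ, ∑' i : S, g (i - ξ) = 1) (hpack : ∀ ξ, ∑' i : S, f (i - ξ) ≤ 1) :
    ∀ᵐ ξ, ∑' i : S, f (i - ξ) = 1 := by
  set F : E → ENNReal := fun x => ∑' i : S, f (i - x)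
  have hFm : Measurable F := Measurable.tsum fun i => by fun_prop
  have h1 : ∀ y, ∫⁻ x, (1 - F x) * g (x - y) = 0 := fun y => by
    have hFg : ∫⁻ x, F x * g (x - y) = 1 :=
      (lintegral_tsum_mul_of_tiling hf hg htile y).trans hf1
    have hgy : ∫⁻ x, g (x - y) = 1 := by rw [lintegral_sub_right_eq_self g y, hg1]
    have hadd : (∫⁻ x, (1 - F x) * g (x - y)) + ∫⁻ x, F x * g (x - y) = 1 := by
      rw [← lintegral_add_right _ (by fun_prop)]
      refine Eq.trans ?_ hgy
      refine lintegral_congr fun x => ?_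
      rw [← add_mul, tsub_add_cancel_of_le (hpack x), one_mul]
    rw [hFg] at hadd
    exact (ENNReal.add_left_inj ENNReal.one_ne_top).1 (hadd.trans (zero_add 1).symm)
  -- Averaging over all translates of `g` leaves only `∫ g = 1` as a weight for the defect `1 - F`.
  have h2 : ∫⁻ x, (1 - F x) = 0 := by
    calc ∫⁻ x, (1 - F x) = ∫⁻ x, ∫⁻ y, (1 - F x) * g (x - y) := by
          refine lintegral_congr fun x => ?_
          rw [lintegral_const_mul _ (by fun_prop), lintegral_sub_left_eq_self g x, hg1, mul_one]
      _ = ∫⁻ y, ∫⁻ x, (1 - F x) * g (x - y) :=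
          lintegral_lintegral_swap (by fun_prop)
      _ = 0 := by simp [h1]
  rw [lintegral_eq_zero_iff (by fun_prop)] at h2
  filter_upwards [h2] with x hx
  exact le_antisymm (hpack x) (tsub_eq_zero_iff_le.1 hx)

/-- The indicator function of `D` packs along a spectrum of `X` because each translate of `D` contains
at most one frequency. -/
theorem not_isSpectral_of_one_lt {X D : Set E} (hX : MeasurableSet X) (hX1 : volume X = 1)
    (hD : MeasurableSet D) (hreg : ∀ a ∈ D, ∀ b ∈ D, fourierIndicator X (a - b) ≠ 0)
    (hD1 : 1 < volume D) : ¬ IsSpectral X := by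
  rintro ⟨S, hS⟩
  have hX' : volume X ≠ ⊤ := by simp [hX1]
  have := hS.countable hX hX1
  refine hD1.not_ge ?_
  rw [← lintegral_indicator_one hD]
  refine lintegral_le_of_packing_of_tiling (S := S) (g := fun ξ => ‖fourierIndicator X ξ‖ₑ ^ 2)
    (measurable_one.indicator hD) ((continuous_fourierIndicator hX hX').measurable.enorm.pow_const 2)
    ((lintegral_enorm_fourierIndicator_sq hX hX').trans hX1)
    (hS.tsum_enorm_fourierIndicator_sq hX hX1) fun ξ => ?_
  by_cases h : ∃ i : S, (i : E) - ξ ∈ D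
  · obtain ⟨i, hi⟩ := h
    rw [tsum_eq_single i]
    · exact Set.indicator_le_self' (fun _ _ => zero_le) _
    · intro j hj
      refine Set.indicator_of_notMem (fun hjD => hreg _ hjD _ hi ?_) _
      rw [sub_sub_sub_cancel_right]
      exact hS.pairwise_fourierIndicator_eq_zero hX hj
  · push Not at h
    simp [h]
end Packing

/-! ### Product domains -/

section Product
variable {m n : ℕ}

local notation "ℝ^" k => EuclideanSpace ℝ (Fin k)

theorem measurableSet_euclideanProd {A : Set (ℝ^m)} {B : Set (ℝ^n)} (hA : MeasurableSet A)
    (hB : MeasurableSet B) : MeasurableSet (euclideanProd A B) :=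
  (WithLp.volume_preserving_ofLp (ℝ^m) (ℝ^n)).measurable (hA.prod hB)

theorem volume_euclideanProd (A : Set (ℝ^m)) (B : Set (ℝ^n)) :
    volume (euclideanProd A B) = volume A * volume B := by
  rw [← Measure.prod_prod, ← Measure.volume_eq_prod]
  exact (WithLp.volume_preserving_symm_measurableEquiv_toLp_prod (ℝ^m) (ℝ^n)).measure_preimage_equiv
    (A ×ˢ B)

theorem euclideanProd_ae_eq {A A' : Set (ℝ^m)} {B B' : Set (ℝ^n)} (hA : A =ᵐ[volume] A')
    (hB : B =ᵐ[volume] B') : euclideanProd A B =ᵐ[volume] euclideanProd A' B' :=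
  (WithLp.volume_preserving_ofLp (ℝ^m) (ℝ^n)).quasiMeasurePreserving.preimage_ae_eq
    (Measure.set_prod_ae_eq hA hB)

theorem fourierIndicator_euclideanProd (A : Set (ℝ^m)) (B : Set (ℝ^n))
    (ζ : WithLp 2 ((ℝ^m) × (ℝ^n))) :
    fourierIndicator (euclideanProd A B) ζ =
      fourierIndicator A ζ.fst * fourierIndicator B ζ.snd := by
  have e := (WithLp.volume_preserving_symm_measurableEquiv_toLp_prod (ℝ^m) (ℝ^n)).symm
  simp only [fourierIndicator, fourier_eq_integral_expFun_smul]
  rw [← integral_prod_mul, ← Measure.volume_eq_prod, ← e.integral_comp']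
  refine integral_congr_ae (.of_forall fun p => ?_)
  have hexp : expFun (-ζ) (WithLp.toLp 2 p) = expFun (-ζ.fst) p.1 * expFun (-ζ.snd) p.2 := by
    simp only [expFun, ← Complex.exp_add, WithLp.prod_inner_apply]
    congr 1; simp; ring
  have hind : (euclideanProd A B).indicator (fun _ => (1 : ℂ)) (WithLp.toLp 2 p) =
      A.indicator (fun _ => 1) p.1 * B.indicator (fun _ => 1) p.2 := by
    by_cases h1 : p.1 ∈ A <;> by_cases h2 : p.2 ∈ B <;> simp [euclideanProd, h1, h2]
  simp only [MeasurableEquiv.symm_symm, MeasurableEquiv.coe_toLp, hexp, hind]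
  ring

theorem measurable_indicator_fst_mul_snd {D : Set (ℝ^m)} (hD : MeasurableSet D)
    {h : (ℝ^n) → ENNReal} (hh : Measurable h) :
    Measurable fun z : WithLp 2 ((ℝ^m) × (ℝ^n)) => D.indicator 1 z.fst * h z.snd :=
  (((measurable_one.indicator hD).comp measurable_fst).mul (hh.comp measurable_snd)).comp
    (WithLp.volume_preserving_ofLp (ℝ^m) (ℝ^n)).measurable

theorem lintegral_indicator_fst_mul_snd {D : Set (ℝ^m)} (hD : MeasurableSet D)
    {h : (ℝ^n) → ENNReal} (hh : Measurable h) :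
    ∫⁻ z : WithLp 2 ((ℝ^m) × (ℝ^n)), D.indicator 1 z.fst * h z.snd = volume D * ∫⁻ b, h b := by
  have e := (WithLp.volume_preserving_toLp (ℝ^m) (ℝ^n)).lintegral_comp
    (measurable_indicator_fst_mul_snd hD hh)
  rw [← e, ← lintegral_indicator_one hD, Measure.volume_eq_prod]
  exact lintegral_prod_mul (measurable_one.indicator hD).aemeasurable hh.aemeasurable

/-- The second coordinates of the points of a spectrum of `A × B` whose first coordinate lies in a
translate of `D` are frequencies of pairwise orthogonal exponentials on `B`. -/
theorem pairwise_fourierIndicator_snd {A D : Set (ℝ^m)} {B : Set (ℝ^n)} (hA : MeasurableSet A)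
    (hB : MeasurableSet B) (hreg : ∀ a ∈ D, ∀ b ∈ D, fourierIndicator A (a - b) ≠ 0)
    {S : Set (WithLp 2 ((ℝ^m) × (ℝ^n)))} (hS : IsSpectrum (euclideanProd A B) S) (x : ℝ^m) :
    Pairwise fun i j : {i : S // i.1.fst - x ∈ D} =>
      fourierIndicator B (i.1.1.snd - j.1.1.snd) = 0 := by
  intro i j hij
  have h := hS.pairwise_fourierIndicator_eq_zero (measurableSet_euclideanProd hA hB)
    (Subtype.coe_injective.ne hij)
  simp only [fourierIndicator_euclideanProd] at h
  refine (mul_eq_zero.1 h).resolve_left ?_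
  simpa using hreg _ i.2 _ j.2

theorem tsum_indicator_mul_eq {D : Set (ℝ^m)} (S : Set (WithLp 2 ((ℝ^m) × (ℝ^n))))
    (h : (ℝ^n) → ENNReal) (ζ : WithLp 2 ((ℝ^m) × (ℝ^n))) :
    ∑' i : S, D.indicator 1 (i.1 - ζ).fst * h (i.1 - ζ).snd =
      ∑' i : {i : S // i.1.fst - ζ.fst ∈ D},
        h (i.1.1.snd - ζ.snd) := by
  refine Eq.trans (tsum_congr fun i => ?_)
    (tsum_subtype {i : S | i.1.fst - ζ.fst ∈ D} fun i => h (i.1.snd - ζ.snd)).symm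
  by_cases hi : i.1.fst - ζ.fst ∈ D <;> simp [hi]

/-- `χ_D(a) |𝓕 χ_B(b)|²` packs along a spectrum of `A × B`. -/
theorem tsum_indicator_mul_le {A D : Set (ℝ^m)} {B : Set (ℝ^n)} (hA : MeasurableSet A)
    (hB : MeasurableSet B) (hB1 : volume B = 1)
    (hreg : ∀ a ∈ D, ∀ b ∈ D, fourierIndicator A (a - b) ≠ 0)
    {S : Set (WithLp 2 ((ℝ^m) × (ℝ^n)))} (hS : IsSpectrum (euclideanProd A B) S)
    (ζ : WithLp 2 ((ℝ^m) × (ℝ^n))) :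
    ∑' i : S, D.indicator 1 (i.1 - ζ).fst *
      ‖fourierIndicator B (i.1 - ζ).snd‖ₑ ^ 2 ≤ 1 := by
  rw [tsum_indicator_mul_eq S (fun b => ‖fourierIndicator B b‖ₑ ^ 2)]
  exact tsum_enorm_fourierIndicator_sq_le hB hB1
    (pairwise_fourierIndicator_snd hA hB hreg hS ζ.fst) ζ.snd

theorem not_isSpectral_euclideanProd_of_one_lt {A D : Set (ℝ^m)} {B : Set (ℝ^n)}
    (hA : MeasurableSet A) (hB : MeasurableSet B) (hA1 : volume A = 1) (hB1 : volume B = 1)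
    (hD : MeasurableSet D) (hreg : ∀ a ∈ D, ∀ b ∈ D, fourierIndicator A (a - b) ≠ 0)
    (hD1 : 1 < volume D) : ¬ IsSpectral (euclideanProd A B) := by
  rintro ⟨S, hS⟩
  have hAB := measurableSet_euclideanProd hA hB
  have hAB1 : volume (euclideanProd A B) = 1 := by rw [volume_euclideanProd, hA1, hB1, one_mul]
  have hAB' : volume (euclideanProd A B) ≠ ⊤ := by simp [hAB1]
  have hB' : volume B ≠ ⊤ := by simp [hB1]
  have := hS.countable hAB hAB1
  have hBm : Measurable fun b => ‖fourierIndicator B b‖ₑ ^ 2 :=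
    (continuous_fourierIndicator hB hB').measurable.enorm.pow_const 2
  refine hD1.not_ge ?_
  have hint := lintegral_indicator_fst_mul_snd (m := m) hD hBm
  rw [lintegral_enorm_fourierIndicator_sq hB hB', hB1, mul_one] at hint
  rw [← hint]
  exact lintegral_le_of_packing_of_tiling (S := S)
    (g := fun ξ => ‖fourierIndicator (euclideanProd A B) ξ‖ₑ ^ 2)
    (measurable_indicator_fst_mul_snd hD hBm)
    ((continuous_fourierIndicator hAB hAB').measurable.enorm.pow_const 2)
    ((lintegral_enorm_fourierIndicator_sq hAB hAB').trans hAB1)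
    (hS.tsum_enorm_fourierIndicator_sq hAB hAB1) (tsum_indicator_mul_le hA hB hB1 hreg hS)

/-- A spectrum of `B` is read off from almost every translate of `D`: it consists of the second
coordinates of the frequencies of `A × B` whose first coordinate lies in that translate. -/
theorem isSpectral_right_of_isSpectral_euclideanProd {A D : Set (ℝ^m)} {B : Set (ℝ^n)}
    (hA : MeasurableSet A) (hB : MeasurableSet B) (hA1 : volume A = 1) (hB1 : volume B = 1)
    (hD : MeasurableSet D) (hreg : ∀ a ∈ D, ∀ b ∈ D, fourierIndicator A (a - b) ≠ 0)
    (hD1 : volume D = 1) (h : IsSpectral (euclideanProd A B)) : IsSpectral B := by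
  obtain ⟨S, hS⟩ := h
  have hAB := measurableSet_euclideanProd hA hB
  have hAB1 : volume (euclideanProd A B) = 1 := by rw [volume_euclideanProd, hA1, hB1, one_mul]
  have hAB' : volume (euclideanProd A B) ≠ ⊤ := by simp [hAB1]
  have hB' : volume B ≠ ⊤ := by simp [hB1]
  have := hS.countable hAB hAB1
  have hBm : Measurable fun b => ‖fourierIndicator B b‖ₑ ^ 2 :=
    (continuous_fourierIndicator hB hB').measurable.enorm.pow_const 2
  have hint := lintegral_indicator_fst_mul_snd (m := m) hD hBm
  rw [lintegral_enorm_fourierIndicator_sq hB hB', hB1, hD1, mul_one] at hint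
  have hae := ae_tiling_of_packing_of_tiling (S := S)
    (g := fun ξ => ‖fourierIndicator (euclideanProd A B) ξ‖ₑ ^ 2)
    (measurable_indicator_fst_mul_snd hD hBm)
    ((continuous_fourierIndicator hAB hAB').measurable.enorm.pow_const 2) hint
    ((lintegral_enorm_fourierIndicator_sq hAB hAB').trans hAB1)
    (hS.tsum_enorm_fourierIndicator_sq hAB hAB1) (tsum_indicator_mul_le hA hB hB1 hreg hS)
  simp_rw [tsum_indicator_mul_eq S (fun b => ‖fourierIndicator B b‖ₑ ^ 2)] at hae
  have hae2 := (WithLp.volume_preserving_toLp (ℝ^m) (ℝ^n)).quasiMeasurePreserving.ae hae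
  obtain ⟨x, hx⟩ := (Measure.ae_ae_of_ae_prod hae2).exists
  have hpair := pairwise_fourierIndicator_snd hA hB hreg hS x
  set s : {i : S // i.1.fst - x ∈ D} → ℝ^n :=
    fun i => i.1.1.snd with hs
  -- Two frequencies with equal second coordinate would have `𝓕 χ_B(0) = 0`, but `𝓕 χ_B(0) = |B| = 1`.
  have hinj : Function.Injective s := by
    intro i j hij
    by_contra hne
    have h0 : fourierIndicator B (s i - s j) = 0 := hpair hne
    rw [hij, sub_self, fourierIndicator_zero hB, hB1] at h0
    simp at h0
  refine ⟨Set.range s, isSpectrum_of_ae_tsum_eq_one hB hB1 ?_ ?_⟩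
  · rintro ⟨_, i, rfl⟩ ⟨_, j, rfl⟩ hij
    exact hpair fun h => hij (by rw [h])
  · filter_upwards [hx] with η hη
    rw [← (Equiv.ofInjective s hinj).tsum_eq]
    exact hη
end Product

theorem theorem2 (m n : ℕ)
    (A : Set (EuclideanSpace ℝ (Fin m))) (B : Set (EuclideanSpace ℝ (Fin n)))
    (hA : NullMeasurableSet A volume) (hB : NullMeasurableSet B volume)
    (hA1 : volume A = 1) (hB1 : volume B = 1)
    (D : Set (EuclideanSpace ℝ (Fin m)))
    (hD : NullMeasurableSet D volume) (hDb : Bornology.IsBounded D)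
    (hreg : (D - D) ∩ fourierZeroSet A = ∅) :
    (volume D = 1 → IsSpectral (euclideanProd A B) → IsSpectral B) ∧
    (1 < volume D → ¬ IsSpectral A ∧ ¬ IsSpectral (euclideanProd A B)) := by
  obtain ⟨A', -, hA', hAA'⟩ := hA.exists_measurable_superset_ae_eq
  obtain ⟨B', -, hB', hBB'⟩ := hB.exists_measurable_superset_ae_eq
  -- `D` is replaced by a subset, so that the condition on `D - D` is inherited.
  obtain ⟨D', hDD', hD', hDae⟩ := hD.exists_measurable_subset_ae_eq
  rw [← measure_congr hAA'] at hA1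
  rw [← measure_congr hBB'] at hB1
  have hreg' : ∀ a ∈ D', ∀ b ∈ D', fourierIndicator A' (a - b) ≠ 0 := by
    intro a ha b hb h0
    rw [← fourierZeroSet_congr hAA'] at hreg
    exact hreg.subset ⟨Set.sub_mem_sub (hDD' ha) (hDD' hb), h0⟩
  have hprod := euclideanProd_ae_eq hAA' hBB'
  rw [← measure_congr hDae]
  refine ⟨fun h1 hsp => ?_, fun h1 => ⟨fun hsp => ?_, fun hsp => ?_⟩⟩
  · exact isSpectral_congr hBB' (isSpectral_right_of_isSpectral_euclideanProd hA' hB' hA1 hB1 hD'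
      hreg' h1 (isSpectral_congr hprod.symm hsp))
  · exact not_isSpectral_of_one_lt hA' hA1 hD' hreg' h1 (isSpectral_congr hAA'.symm hsp)
  · exact not_isSpectral_euclideanProd_of_one_lt hA' hB' hA1 hB1 hD' hreg' h1
      (isSpectral_congr hprod.symm hsp)
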